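/- \textbf{Relation algebras.} A \emph{relation algebra} is a Boolean algebra $(A,+,-)$ with a binary operation $;$, a unary operation ${}^{\smile}$ and a constant $1'$ such that for all $r,s,t\in A$: $r;(s;t)=(r;s);t$, $r;1'=r$, $r^{\smile\smile}=r$, $(r;s)^{\smile}=s^{\smile};r^{\smile}$, $(r+s);t=r;t+s;t$, $(r+s)^{\smile}=r^{\smile}+s^{\smile}$, and $(r;s)\cdot t=0$ implies $(r^{\smile};t)\cdot s=0$. Let $1$ be the unit of $A$. An element $f$ is \emph{functional} if $f^{\smile};f\le 1'$. An element $x\le 1'$ is \emph{measurable} if it is an atom and $x;1;x$ is the sum (supremum) of a set of functional elements; its \emph{measure} is the number (cardinality) of non-zero functional elements below $x;1;x$. The algebra is \emph{measurable} if $1'$ is the sum of a set of measurable elements, \emph{complete} if every subset has a supremum, and \emph{atomic} if every non-zero element is above an atom. \textbf{Group triples.} A \emph{group triple} $\mathcal F=(G,\varphi,C)$ consists of a family $(G_x)_{x\in I}$ of pairwise disjoint groups (with identity elements $e_x$), an equivalence relation $\mathcal E$ on $I$, for each $(x,y)\in\mathcal E$ an isomorphism $\varphi_{xy}:G_x/H_{xy}\to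 G_y/K_{xy}$, where $H_{xy}$ and $K_{xy}$ are normal subgroups of $G_x$ and $G_y$ respectively, and, for all $x,y,z$ with $(x,y),(y,z)\in\mathcal E$, a coset $C_{xyz}$ of $H_{xy}\circ H_{xz}$ in $G_x$. Here $\circ$ is the product of subsets of a group, and for a union $Q$ of cosets of $H_{xy}$, $\varphi_{xy}[Q]$ is the union of the cosets $\varphi_{xy}(D)$, $D\in G_x/H_{xy}$, $D\subseteq Q$; similarly for $\varphi_{xy}^{-1}[Q]$ when $Q$ is a union of cosets of $K_{xy}$. It is a \emph{semi-frame} if, for all $x$, all $(x,y)\in\mathcal E$, and all $x,y,z$ with $(x,y),(y,z)\in\mathcal E$: (i) $\varphi_{xx}$ is the identity automorphism of $G_x/\{e_x\}$; (ii) $\varphi_{yx}=\varphi_{xy}^{-1}$; (iii) $\varphi_{xy}[H_{xy}\circ H_{xz}]=K_{xy}\circ H_{yz}$; (iv) $\varphi_{yz}[\varphi_{xy}[D]]=\varphi_{xz}[C_{xyz}^{-1}\circ D\circ C_{xyz}]$ for every coset $D$ of $H_{xy}\circ H_{xz}$. It satisfies the \emph{coset conditions} if, for all $x,y,z,w$ lying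 in one class of $\mathcal E$: (i) $C_{xyy}=H_{xy}$; (ii) $\varphi_{xz}[C_{xyz}]=C_{zyx}^{-1}$; (iii) $\varphi_{xy}[C_{xyz}]=C_{yxz}^{-1}$; (iv) $C_{xyz}\circ C_{xzw}=\varphi_{yx}[C_{yzw}\circ H_{yx}]\circ C_{xyw}$. \textbf{The algebra $\mathfrak C[\mathcal F]$.} For $(x,y)\in\mathcal E$ index the cosets of $H_{xy}$ without repetition as $H_{xy,\alpha}$ (the index $\alpha$ may be taken to be the coset itself), with $H_{xy,0}=H_{xy}$, and put $K_{xy,\alpha}=\varphi_{xy}(H_{xy,\alpha})$ and $$R_{xy,\alpha}=\bigcup_\gamma H_{xy,\gamma}\times(K_{xy,\gamma}\circ K_{xy,\alpha}).$$ Let $$U=\bigcup\{G_x:x\in I\},\qquad E=\bigcup\{G_x\times G_y:(x,y)\in\mathcal E\},$$ and let $A$ (the \emph{frame relations}) be the collection of all unions of sets of relations $R_{xy,\alpha}$. The \emph{shifted product} $\otimes$ on $A$ is defined by $$R_{xy,\alpha}\otimes R_{yz,\beta}=\bigcup\{R_{xz,\gamma}:H_{xz,\gamma}\subseteq\varphi_{xy}^{-1}[K_{xy,\alpha}\circ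 H_{yz,\beta}]\circ C_{xyz}\},$$ $R_{xy,\alpha}\otimes R_{wz,\beta}=\varnothing$ for $y\ne w$, and distributivity over arbitrary unions. Let $\mathfrak C[\mathcal F]$ have universe $A$ and the operations of union, complement relative to $E$, $\otimes$ (as relative multiplication), relational converse, and the identity relation $\mathrm{id}_U$ (as identity element). \textbf{Theorem (Coset Semi-frame Theorem).} \label{T:costhm} If $\mathcal F$ is a semi-frame satisfying the coset conditions, then $\mathfrak C[\mathcal F]$ is a well-defined complete, atomic, measurable relation algebra with base set $U$ and unit $E$. Its atoms are the relations $R_{xy,\alpha}$ for $(x,y)\in\mathcal E$ and all indices $\alpha$; its subidentity atoms (atoms below $\mathrm{id}_U$) are the relations $R_{xx,0}$ for $x\in I$; and each $R_{xx,0}$ is measurable, with measure $|G_x|$. -/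

import Mathlib

open scoped Pointwise

universe u v

/-- A relation algebra: a Boolean algebra with a binary operation `comp` (relative
multiplication `;`), a unary operation `conv` (converse) and a constant `ident` (the identity
element `1'`), subject to the associative law, the identity law, the two involution laws, the two
distributive laws and the cycle law. -/
class RelationAlgebra (A : Type u) extends BooleanAlgebra A where
  comp : A → A → A
  conv : A → A
  ident : A
  comp_assoc : ∀ r s t : A, comp r (comp s t) = comp (comp r s) t
  comp_ident : ∀ r : A, comp r ident = r
  conv_conv : ∀ r : A, conv (conv r) = r
  conv_comp : ∀ r s : A, conv (comp r s) = comp (conv s) (conv r)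
  sup_comp : ∀ r s t : A, comp (r ⊔ s) t = comp r t ⊔ comp s t
  conv_sup : ∀ r s : A, conv (r ⊔ s) = conv r ⊔ conv s
  cycle : ∀ r s t : A, comp r s ⊓ t = ⊥ → comp (conv r) t ⊓ s = ⊥

namespace RelationAlgebra

variable {A : Type u} [RelationAlgebra A]

/-- `f` is functional: `f˘ ; f ≤ 1'`. -/
def IsFunctional (f : A) : Prop :=
  comp (conv f) f ≤ ident

/-- The square `x ; 1 ; x`. -/
def square (x : A) : A :=
  comp (comp x ⊤) x

/-- A subidentity element is measurable if it is an atom and its square is the sum (supremum) of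
a set of functional elements. -/
def IsMeasurableElement (x : A) : Prop :=
  x ≤ ident ∧ IsAtom x ∧ ∃ S : Set A, (∀ f ∈ S, IsFunctional f) ∧ IsLUB S (square x)

/-- The measure of `x`: the number of non-zero functional elements below the square of `x`. -/
noncomputable def measure (x : A) : Cardinal.{u} :=
  Cardinal.mk {f : A // f ≠ ⊥ ∧ IsFunctional f ∧ f ≤ square x}

variable (A) in
/-- The relation algebra `A` is measurable: the identity element is the sum of a set of
measurable elements. -/
def IsMeasurableAlgebra : Prop :=
  ∃ S : Set A, (∀ x ∈ S, IsMeasurableElement x) ∧ IsLUB S ident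

end RelationAlgebra

/-- A group triple: a family `G` of groups indexed by `I`, an equivalence relation `E` on `I`, for
each `(x, y) ∈ E` an isomorphism `φ` from a quotient `G x / H` of `G x` onto a quotient `G y / K`
of `G y`, and, for each triple `x, y, z` with `(x, y), (y, z) ∈ E`, a coset `C` in `G x` of the
normal subgroup `H_xy ∘ H_xz`. -/
structure GroupTriple {I : Type u} (G : I → Type v) [∀ x, Group (G x)] where
  E : I → I → Prop
  equiv : Equivalence E
  H : ∀ {x y : I}, E x y → Subgroup (G x)
  K : ∀ {x y : I}, E x y → Subgroup (G y)
  [H_normal : ∀ {x y : I} (h : E x y), (H h).Normal]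
  [K_normal : ∀ {x y : I} (h : E x y), (K h).Normal]
  φ : ∀ {x y : I} (h : E x y), G x ⧸ H h ≃* G y ⧸ K h
  C : ∀ {x y z : I}, E x y → E y z → Set (G x)
  C_coset : ∀ {x y z : I} (hxy : E x y) (hyz : E y z), ∃ g : G x,
    C hxy hyz = {g} * ((H hxy : Set (G x)) * (H (equiv.trans hxy hyz) : Set (G x)))

namespace GroupTriple

attribute [instance] GroupTriple.H_normal GroupTriple.K_normal

variable {I : Type u} {G : I → Type v} [∀ x, Group (G x)] (F : GroupTriple G)

/-- An element of a quotient group, viewed as a set of group elements. -/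
def cosetSet {Γ : Type v} [Group Γ] (N : Subgroup Γ) (α : Γ ⧸ N) : Set Γ :=
  {g | (g : Γ ⧸ N) = α}

/-- The image `φ_xy[Q]` of a union `Q` of cosets of `H_xy`: the union of the cosets of `K_xy`
that are values of `φ_xy` on the cosets of the elements of `Q`. -/
def image {x y : I} (h : F.E x y) (Q : Set (G x)) : Set (G y) :=
  {b | ∃ a ∈ Q, F.φ h (a : G x ⧸ F.H h) = (b : G y ⧸ F.K h)}

/-- The inverse image `φ_xy⁻¹[Q]` of a union `Q` of cosets of `K_xy`. -/
def preimage {x y : I} (h : F.E x y) (Q : Set (G y)) : Set (G x) :=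
  {a | ∃ b ∈ Q, F.φ h (a : G x ⧸ F.H h) = (b : G y ⧸ F.K h)}

/-- The base set: the disjoint union of the groups. -/
abbrev U (_ : GroupTriple G) : Type (max u v) := Σ x : I, G x

/-- The set `E = ⋃ {G_x × G_y : (x, y) ∈ 𝓔}` of pairs of elements of the base set. -/
def unitRel : Set (F.U × F.U) :=
  {p | F.E p.1.1 p.2.1}

/-- The coset `H_{xy,α}` of `H_xy`, where the index `α` is the coset as an element of
`G_x / H_xy`. -/
def Hc {x y : I} (h : F.E x y) (α : G x ⧸ F.H h) : Set (G x) :=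
  cosetSet (F.H h) α

/-- The associated coset `K_{xy,α} = φ_xy(H_{xy,α})` of `K_xy`. -/
def Kc {x y : I} (h : F.E x y) (α : G x ⧸ F.H h) : Set (G y) :=
  cosetSet (F.K h) (F.φ h α)

/-- The relation `R_{xy,α} = ⋃_γ H_{xy,γ} × (K_{xy,γ} ∘ K_{xy,α})`. -/
def R {x y : I} (h : F.E x y) (α : G x ⧸ F.H h) : Set (F.U × F.U) :=
  ⋃ γ : G x ⧸ F.H h, (Sigma.mk x '' F.Hc h γ) ×ˢ (Sigma.mk y '' (F.Kc h γ * F.Kc h α))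

/-- The set of all relations `R_{xy,α}`. -/
def basicRels : Set (Set (F.U × F.U)) :=
  {S | ∃ (x y : I) (h : F.E x y) (α : G x ⧸ F.H h), S = F.R h α}

/-- The frame relations: the unions of arbitrary sets of relations `R_{xy,α}`. -/
@[ext]
structure FrameRel where
  toSet : Set (F.U × F.U)
  isUnion : ∃ X : Set (Set (F.U × F.U)), X ⊆ F.basicRels ∧ toSet = ⋃₀ X

/-- The relation `R_{xy,α}` as a frame relation. -/
def basic {x y : I} (h : F.E x y) (α : G x ⧸ F.H h) : F.FrameRel where
  toSet := F.R h α
  isUnion := ⟨{F.R h α}, by rintro _ rfl; exact ⟨x, y, h, α, rfl⟩, by simp⟩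

/-- The product `R_{xy,α} ⊗ R_{yz,β}`, that is, the union of all `R_{xz,γ}` such that
`H_{xz,γ} ⊆ φ_xy⁻¹[K_{xy,α} ∘ H_{yz,β}] ∘ C_xyz`. -/
def basicMul {x y z : I} (hxy : F.E x y) (hyz : F.E y z) (α : G x ⧸ F.H hxy)
    (β : G y ⧸ F.H hyz) : Set (F.U × F.U) :=
  ⋃ (γ : G x ⧸ F.H (F.equiv.trans hxy hyz))
    (_ : F.Hc (F.equiv.trans hxy hyz) γ ⊆
      F.preimage hxy (F.Kc hxy α * F.Hc hyz β) * F.C hxy hyz),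
    F.R (F.equiv.trans hxy hyz) γ

/-- The shifted product `S ⊗ T`: the union of the products of the relations `R_{xy,α} ⊆ S` with
the relations `R_{wz,β} ⊆ T`. Since the product of `R_{xy,α}` and `R_{wz,β}` is empty for
`y ≠ w`, only the pairs with `y = w` occur in the union. -/
def shiftMul (S T : Set (F.U × F.U)) : Set (F.U × F.U) :=
  {p | ∃ (x y z : I) (hxy : F.E x y) (hyz : F.E y z) (α : G x ⧸ F.H hxy) (β : G y ⧸ F.H hyz),
    F.R hxy α ⊆ S ∧ F.R hyz β ⊆ T ∧ p ∈ F.basicMul hxy hyz α β}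

/-- The semi-frame conditions. -/
structure IsSemiFrame : Prop where
  /-- `φ_xx` is the identity automorphism of `G_x / {e}`. -/
  ident : ∀ x : I, F.H (F.equiv.refl x) = ⊥ ∧ F.K (F.equiv.refl x) = ⊥ ∧
    ∀ g : G x, F.φ (F.equiv.refl x) (g : G x ⧸ F.H (F.equiv.refl x)) =
      (g : G x ⧸ F.K (F.equiv.refl x))
  /-- `φ_yx` is the inverse of `φ_xy`. -/
  inverse : ∀ {x y : I} (h : F.E x y),
    F.H (F.equiv.symm h) = F.K h ∧ F.K (F.equiv.symm h) = F.H h ∧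
    ∀ (a : G x) (b : G y), F.φ h (a : G x ⧸ F.H h) = (b : G y ⧸ F.K h) ↔
      F.φ (F.equiv.symm h) (b : G y ⧸ F.H (F.equiv.symm h)) =
        (a : G x ⧸ F.K (F.equiv.symm h))
  /-- `φ_xy[H_xy ∘ H_xz] = K_xy ∘ H_yz`. -/
  image_eq : ∀ {x y z : I} (hxy : F.E x y) (hyz : F.E y z),
    F.image hxy ((F.H hxy : Set (G x)) * (F.H (F.equiv.trans hxy hyz) : Set (G x))) =
      (F.K hxy : Set (G y)) * (F.H hyz : Set (G y))
  /-- The composition of the isomorphisms induced by `φ_xy` and `φ_yz` equals the composition of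
  the inner automorphism `D ↦ C_xyz⁻¹ ∘ D ∘ C_xyz` of `G_x / (H_xy ∘ H_xz)` with the isomorphism
  induced by `φ_xz`; here `D` is the coset of `g`, and an induced isomorphism maps a coset to its
  image as a set. -/
  comp_eq : ∀ {x y z : I} (hxy : F.E x y) (hyz : F.E y z) (g : G x) (D : Set (G x)),
    D = {g} * ((F.H hxy : Set (G x)) * (F.H (F.equiv.trans hxy hyz) : Set (G x))) →
    F.image hyz (F.image hxy D) =
      F.image (F.equiv.trans hxy hyz) ((F.C hxy hyz)⁻¹ * D * F.C hxy hyz)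

/-- The coset conditions for the identity law, the second involution law, the cycle law and the
associative law. -/
structure CosetConditions : Prop where
  /-- `C_xyy = H_xy`. -/
  identity : ∀ {x y : I} (h : F.E x y), F.C h (F.equiv.refl y) = (F.H h : Set (G x))
  /-- `φ_xz[C_xyz] = C_zyx⁻¹`. -/
  involution : ∀ {x y z : I} (hxy : F.E x y) (hyz : F.E y z),
    F.image (F.equiv.trans hxy hyz) (F.C hxy hyz) =
      (F.C (F.equiv.symm hyz) (F.equiv.symm hxy))⁻¹
  /-- `φ_xy[C_xyz] = C_yxz⁻¹`. -/
  cycle : ∀ {x y z : I} (hxy : F.E x y) (hyz : F.E y z),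
    F.image hxy (F.C hxy hyz) = (F.C (F.equiv.symm hxy) (F.equiv.trans hxy hyz))⁻¹
  /-- `C_xyz ∘ C_xzw = φ_yx[C_yzw ∘ H_yx] ∘ C_xyw`. -/
  associative : ∀ {x y z w : I} (hxy : F.E x y) (hyz : F.E y z) (hzw : F.E z w),
    F.C hxy hyz * F.C (F.equiv.trans hxy hyz) hzw =
      F.image (F.equiv.symm hxy) (F.C hyz hzw * (F.H (F.equiv.symm hxy) : Set (G y))) *
        F.C hxy (F.equiv.trans hyz hzw)

end GroupTriple

/-! ### The relations `R` partition the unit -/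

namespace GroupTriple

variable {I : Type u} {G : I → Type v} [∀ x, Group (G x)] {F : GroupTriple G}

/-! A pair `(a, b)` lies in `R_{xy,α}` exactly when `φ_xy(aα) = b`, so each pair of the unit
determines `x`, `y` and `α`. The relations `R_{xy,α}` are therefore non-empty blocks partitioning
`E`, and the frame relations are all unions of blocks: a complete atomic Boolean algebra whose atoms
are the blocks.

Every relation algebra law can then be tested on atoms. Representing `α` by an element `a` of `G_x`,
the block labelled `c` lies in the product of the blocks labelled `a` and `b` iff `c ∈ a · φ_xy⁻¹(b)
· C_xyz`, which is `Triple`; `Triple.congr` makes this independent of representatives. The converse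
of the block labelled `a` is labelled `φ_xy(a)⁻¹`. The laws become computations in the groups:
`triple_refl_iff`, `Triple.cycle`, `Triple.conv` and `Triple.assoc`, each resting on the coset
condition of the same purpose. The last two also need `Corr.trans`: `φ_yz ∘ φ_xy` is `φ_xz` after
conjugation by `C_xyz`, modulo `H_xy ∘ H_xz`. They give only one inclusion; converse supplies the
other.

On `G_x × G_x` the subgroup `H_xx` and the coset `C_xxx` are trivial, so the blocks are the graphs
of the right translations of `G_x` and multiply as in `G_x`. They are exactly the non-zero
functional elements below the square of `R_{xx,0}`, whence measurability and the measure `|G_x|`. -/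

theorem mem_R {x y : I} {h : F.E x y} {α : G x ⧸ F.H h} {p : F.U × F.U} :
    p ∈ F.R h α ↔ ∃ (a : G x) (b : G y), p = (⟨x, a⟩, ⟨y, b⟩) ∧ F.φ h (a * α) = b := by
  simp only [R, Set.mem_iUnion, Set.mem_prod, Set.mem_image]
  constructor
  · rintro ⟨γ, ⟨a, ha, ha'⟩, ⟨b, hb, hb'⟩⟩
    obtain ⟨b₁, hb₁, b₂, hb₂, rfl⟩ := Set.mem_mul.1 hb
    refine ⟨a, b₁ * b₂, Prod.ext ha'.symm hb'.symm, ?_⟩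
    simp only [Hc, Kc, cosetSet, Set.mem_ofPred_eq] at ha hb₁ hb₂
    rw [map_mul, ha, ← hb₁, ← hb₂]
    rfl
  · rintro ⟨a, b, rfl, hab⟩
    refine ⟨a, ⟨a, rfl, rfl⟩, b, ?_, rfl⟩
    obtain ⟨b₁, hb₁⟩ := QuotientGroup.mk_surjective (F.φ h (a : G x ⧸ F.H h))
    refine Set.mem_mul.2 ⟨b₁, hb₁, b₁⁻¹ * b, ?_, by simp⟩
    change ((b₁⁻¹ * b : G y) : G y ⧸ F.K h) = _
    rw [QuotientGroup.mk_mul, QuotientGroup.mk_inv, hb₁, ← hab, map_mul, inv_mul_cancel_left]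

theorem mk_mem_R {x y : I} {h : F.E x y} {α : G x ⧸ F.H h} {a : G x} {b : G y} :
    ((⟨x, a⟩, ⟨y, b⟩) : F.U × F.U) ∈ F.R h α ↔ F.φ h (a * α) = b := by
  rw [mem_R]
  constructor
  · rintro ⟨a', b', hp, h'⟩
    simp only [Prod.mk.injEq, Sigma.mk.injEq, heq_eq_eq, true_and] at hp
    obtain ⟨rfl, rfl⟩ := hp
    exact h'
  · exact fun h' => ⟨a, b, rfl, h'⟩

theorem R_nonempty {x y : I} (h : F.E x y) (α : G x ⧸ F.H h) : (F.R h α).Nonempty := by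
  obtain ⟨b, hb⟩ := QuotientGroup.mk_surjective (F.φ h ((1 : G x) * α))
  exact ⟨(⟨x, 1⟩, ⟨y, b⟩), mk_mem_R.2 hb.symm⟩

theorem R_subset_unitRel {x y : I} (h : F.E x y) (α : G x ⧸ F.H h) : F.R h α ⊆ F.unitRel := by
  intro p hp
  obtain ⟨a, b, rfl, -⟩ := mem_R.1 hp
  exact h

theorem exists_mem_R {p : F.U × F.U} (hp : p ∈ F.unitRel) :
    ∃ (x y : I) (h : F.E x y) (α : G x ⧸ F.H h), p ∈ F.R h α := by
  obtain ⟨⟨x, a⟩, ⟨y, b⟩⟩ := p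
  have h : F.E x y := hp
  exact ⟨x, y, h, (a : G x ⧸ F.H h)⁻¹ * (F.φ h).symm b, mk_mem_R.2 (by simp)⟩

theorem index_unique {x y : I} {h : F.E x y} {α β : G x ⧸ F.H h} {p : F.U × F.U}
    (hα : p ∈ F.R h α) (hβ : p ∈ F.R h β) : α = β := by
  obtain ⟨a, b, rfl, hab⟩ := mem_R.1 hα
  rw [mk_mem_R, ← hab] at hβ
  exact (mul_left_cancel ((F.φ h).injective hβ)).symm

theorem R_eq_of_mem {x y x' y' : I} {h : F.E x y} {h' : F.E x' y'} {α : G x ⧸ F.H h}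
    {β : G x' ⧸ F.H h'} {p : F.U × F.U} (hα : p ∈ F.R h α) (hβ : p ∈ F.R h' β) :
    F.R h α = F.R h' β := by
  obtain ⟨a, b, rfl, hab⟩ := mem_R.1 hα
  obtain ⟨a', b', hp, -⟩ := mem_R.1 hβ
  simp only [Prod.mk.injEq, Sigma.mk.injEq] at hp
  obtain ⟨⟨rfl, -⟩, ⟨rfl, -⟩⟩ := hp
  rw [index_unique hα hβ]

/-- Trades the unspecified family `X` for a pointwise criterion, so that closure of the frame
relations under each operation can be checked one pair at a time. -/
theorem exists_sUnion_basicRels_iff {Z : Set (F.U × F.U)} :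
    (∃ X : Set (Set (F.U × F.U)), X ⊆ F.basicRels ∧ Z = ⋃₀ X) ↔
      ∀ p ∈ Z, ∃ (x y : I) (h : F.E x y) (α : G x ⧸ F.H h), p ∈ F.R h α ∧ F.R h α ⊆ Z := by
  constructor
  · rintro ⟨X, hX, rfl⟩ p ⟨S, hS, hp⟩
    obtain ⟨x, y, h, α, rfl⟩ := hX hS
    exact ⟨x, y, h, α, hp, Set.subset_sUnion_of_mem hS⟩
  · intro hZ
    refine ⟨{S | S ∈ F.basicRels ∧ S ⊆ Z}, fun S hS => hS.1, ?_⟩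
    refine Set.Subset.antisymm (fun p hp => ?_) (Set.sUnion_subset fun S hS => hS.2)
    obtain ⟨x, y, h, α, hp', hs⟩ := hZ p hp
    exact ⟨_, ⟨⟨x, y, h, α, rfl⟩, hs⟩, hp'⟩

/-! ### The Boolean algebra of frame relations -/

namespace FrameRel

theorem exists_R_subset (S : F.FrameRel) {p : F.U × F.U} (hp : p ∈ S.toSet) :
    ∃ (x y : I) (h : F.E x y) (α : G x ⧸ F.H h), p ∈ F.R h α ∧ F.R h α ⊆ S.toSet :=
  exists_sUnion_basicRels_iff.1 S.isUnion p hp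

/-- Blocks that meet coincide, so a frame relation contains every block it meets. Closure under
intersection and complement rests on this. -/
theorem R_subset_of_mem (S : F.FrameRel) {p : F.U × F.U} {x y : I} {h : F.E x y}
    {α : G x ⧸ F.H h} (hα : p ∈ F.R h α) (hp : p ∈ S.toSet) : F.R h α ⊆ S.toSet := by
  obtain ⟨x', y', h', β, hβ, hs⟩ := S.exists_R_subset hp
  rwa [R_eq_of_mem hα hβ]

theorem subset_unitRel (S : F.FrameRel) : S.toSet ⊆ F.unitRel := by
  intro p hp
  obtain ⟨x, y, h, α, hα, -⟩ := S.exists_R_subset hp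
  exact R_subset_unitRel h α hα

/-- The frame relation given by a union of relations `R_{xy,α}`. -/
def ofSet (Z : Set (F.U × F.U))
    (hZ : ∀ p ∈ Z, ∃ (x y : I) (h : F.E x y) (α : G x ⧸ F.H h), p ∈ F.R h α ∧ F.R h α ⊆ Z) :
    F.FrameRel :=
  ⟨Z, exists_sUnion_basicRels_iff.2 hZ⟩

/-- The union of a set of frame relations. -/
def union (𝒮 : Set F.FrameRel) : F.FrameRel :=
  ofSet (⋃ S ∈ 𝒮, S.toSet) fun p hp => by
    simp only [Set.mem_iUnion] at hp
    obtain ⟨S, hS, hp⟩ := hp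
    obtain ⟨x, y, h, α, hα, hs⟩ := S.exists_R_subset hp
    exact ⟨x, y, h, α, hα, hs.trans (Set.subset_biUnion_of_mem (u := toSet) hS)⟩

scoped instance : Max F.FrameRel where
  max S T := ofSet (S.toSet ∪ T.toSet) fun p hp => by
    rcases hp with hp | hp
    · obtain ⟨x, y, h, α, hα, hs⟩ := S.exists_R_subset hp
      exact ⟨x, y, h, α, hα, hs.trans Set.subset_union_left⟩
    · obtain ⟨x, y, h, α, hα, hs⟩ := T.exists_R_subset hp
      exact ⟨x, y, h, α, hα, hs.trans Set.subset_union_right⟩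

scoped instance : Min F.FrameRel where
  min S T := ofSet (S.toSet ∩ T.toSet) fun p hp => by
    obtain ⟨x, y, h, α, hα, hs⟩ := S.exists_R_subset hp.1
    exact ⟨x, y, h, α, hα, Set.subset_inter hs (T.R_subset_of_mem hα hp.2)⟩

scoped instance : Top F.FrameRel where
  top := ofSet F.unitRel fun p hp => by
    obtain ⟨x, y, h, α, hα⟩ := exists_mem_R hp
    exact ⟨x, y, h, α, hα, R_subset_unitRel h α⟩

scoped instance : Bot F.FrameRel where
  bot := ofSet ∅ fun _ hp => hp.elim

scoped instance : Compl F.FrameRel where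
  compl S := ofSet (F.unitRel \ S.toSet) fun p hp => by
    obtain ⟨x, y, h, α, hα⟩ := exists_mem_R hp.1
    refine ⟨x, y, h, α, hα, fun q hq => ⟨R_subset_unitRel _ _ hq, fun hqS => hp.2 ?_⟩⟩
    exact S.R_subset_of_mem hq hqS hα

scoped instance : SDiff F.FrameRel where
  sdiff S T := S ⊓ Tᶜ

scoped instance : HImp F.FrameRel where
  himp S T := T ⊔ Sᶜ

scoped instance : LE F.FrameRel where
  le S T := S.toSet ⊆ T.toSet

scoped instance : LT F.FrameRel where
  lt S T := S.toSet ⊂ T.toSet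

/-- A frame relation as a set of elements of the unit. -/
def restrict (S : F.FrameRel) : Set F.unitRel :=
  Subtype.val ⁻¹' S.toSet

theorem restrict_injective : Function.Injective (restrict (F := F)) := by
  intro S T h
  refine FrameRel.ext (Set.ext fun p => ⟨fun hp => ?_, fun hp => ?_⟩)
  · exact h.le (show (⟨p, S.subset_unitRel hp⟩ : F.unitRel) ∈ S.restrict from hp)
  · exact h.ge (show (⟨p, T.subset_unitRel hp⟩ : F.unitRel) ∈ T.restrict from hp)

theorem restrict_le_restrict {S T : F.FrameRel} : S.restrict ≤ T.restrict ↔ S ≤ T :=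
  ⟨fun h p hp => h (show (⟨p, S.subset_unitRel hp⟩ : F.unitRel) ∈ S.restrict from hp),
    fun h _ hp => h hp⟩

theorem restrict_compl (S : F.FrameRel) : (Sᶜ).restrict = (S.restrict)ᶜ :=
  Set.ext fun p => ⟨fun hp => hp.2, fun hp => ⟨p.2, hp⟩⟩

-- Complements are taken relative to `E`, so the axioms are pulled back from the power set of `E`,
-- not from that of `U × U`.
scoped instance : BooleanAlgebra F.FrameRel :=
  restrict_injective.booleanAlgebra restrict restrict_le_restrict
    (by
      intro S T
      rw [lt_iff_le_not_ge, restrict_le_restrict, restrict_le_restrict]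
      rfl)
    (fun _ _ => rfl) (fun _ _ => rfl) (Set.ext fun p => ⟨fun _ => trivial, fun _ => p.2⟩) rfl
    restrict_compl
    (fun S T => by rw [sdiff_eq, ← restrict_compl]; rfl)
    (fun S T => by rw [himp_eq, ← restrict_compl]; rfl)

theorem le_iff_R {S T : F.FrameRel} :
    S ≤ T ↔ ∀ (x y : I) (h : F.E x y) (a : G x), F.R h a ⊆ S.toSet → F.R h a ⊆ T.toSet := by
  refine ⟨fun hST x y h a hS => hS.trans hST, fun H p hp => ?_⟩
  obtain ⟨x, y, h, α, hα, hs⟩ := S.exists_R_subset hp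
  obtain ⟨a, rfl⟩ := QuotientGroup.mk_surjective α
  exact H x y h a hs hα

theorem R_subset_sup {S T : F.FrameRel} {x y : I} {h : F.E x y} {α : G x ⧸ F.H h} :
    F.R h α ⊆ (S ⊔ T).toSet ↔ F.R h α ⊆ S.toSet ∨ F.R h α ⊆ T.toSet := by
  refine ⟨fun H => ?_, fun H => H.elim (fun h => h.trans Set.subset_union_left)
    (fun h => h.trans Set.subset_union_right)⟩
  obtain ⟨p, hp⟩ := R_nonempty h α
  exact (H hp).imp (S.R_subset_of_mem hp) (T.R_subset_of_mem hp)

theorem inf_eq_bot_iff {S T : F.FrameRel} :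
    S ⊓ T = ⊥ ↔ ∀ (x y : I) (h : F.E x y) (a : G x),
      F.R h a ⊆ S.toSet → F.R h a ⊆ T.toSet → False := by
  constructor
  · intro H x y h a hS hT
    obtain ⟨p, hp⟩ := R_nonempty h (a : G x ⧸ F.H h)
    have : p ∈ (S ⊓ T).toSet := ⟨hS hp, hT hp⟩
    rw [H] at this
    exact this
  · intro H
    rw [eq_bot_iff, le_iff_R]
    exact fun x y h a hST => (H x y h a (fun p hp => (hST hp).1) fun p hp => (hST hp).2).elim

end FrameRel

/-! ### Atoms and suprema -/

open scoped FrameRel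

theorem basic_ne_bot {x y : I} (h : F.E x y) (α : G x ⧸ F.H h) : F.basic h α ≠ ⊥ := by
  intro H
  obtain ⟨p, hp⟩ := R_nonempty h α
  have : p ∈ (F.basic h α).toSet := hp
  rw [H] at this
  exact this

theorem exists_basic_le {S : F.FrameRel} (hS : S ≠ ⊥) :
    ∃ (x y : I) (h : F.E x y) (α : G x ⧸ F.H h), F.basic h α ≤ S := by
  by_contra! H
  refine hS (eq_bot_iff.2 fun p hp => ?_)
  obtain ⟨x, y, h, α, -, hs⟩ := S.exists_R_subset hp
  exact (H x y h α hs).elim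

theorem isAtom_basic {x y : I} (h : F.E x y) (α : G x ⧸ F.H h) : IsAtom (F.basic h α) := by
  refine ⟨basic_ne_bot h α, fun S hS => ?_⟩
  by_contra hne
  obtain ⟨x', y', h', β, hβ⟩ := exists_basic_le hne
  obtain ⟨p, hp⟩ := R_nonempty h' β
  refine hS.not_ge ?_
  exact S.R_subset_of_mem (hS.le (hβ hp)) (hβ hp)

theorem isAtom_iff {S : F.FrameRel} : IsAtom S ↔
    ∃ (x y : I) (h : F.E x y) (α : G x ⧸ F.H h), S = F.basic h α := by
  constructor
  · intro hS
    obtain ⟨x, y, h, α, hα⟩ := exists_basic_le hS.1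
    exact ⟨x, y, h, α, ((hS.le_iff.1 hα).resolve_left (basic_ne_bot h α)).symm⟩
  · rintro ⟨x, y, h, α, rfl⟩
    exact isAtom_basic h α

theorem isAtomic_frameRel : IsAtomic F.FrameRel := by
  refine ⟨fun S => or_iff_not_imp_left.2 fun hS => ?_⟩
  obtain ⟨x, y, h, α, hα⟩ := exists_basic_le hS
  exact ⟨_, isAtom_basic h α, hα⟩

theorem FrameRel.isLUB_union (𝒮 : Set F.FrameRel) : IsLUB 𝒮 (FrameRel.union 𝒮) :=
  ⟨fun _ hS => Set.subset_biUnion_of_mem (u := FrameRel.toSet) hS,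
    fun _ hT => Set.iUnion₂_subset fun _ hS => hT hS⟩

/-! ### The correspondence between group elements induced by the quotient isomorphisms -/

section Elements

variable {x y z w : I}

variable (F) in
/-- The elements `a` and `b` lie in cosets that correspond to each other under `φ_xy`. -/
def Corr {x y : I} (h : F.E x y) (a : G x) (b : G y) : Prop :=
  F.φ h (a : G x ⧸ F.H h) = (b : G y ⧸ F.K h)

namespace Corr

variable {h : F.E x y} {a a' : G x} {b b' : G y}

theorem mul (hab : F.Corr h a b) (hab' : F.Corr h a' b') : F.Corr h (a * a') (b * b') := by
  unfold Corr at *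
  rw [QuotientGroup.mk_mul, QuotientGroup.mk_mul, map_mul, hab, hab']

theorem inv (hab : F.Corr h a b) : F.Corr h a⁻¹ b⁻¹ := by
  unfold Corr at *
  rw [QuotientGroup.mk_inv, QuotientGroup.mk_inv, map_inv, hab]

theorem one (h : F.E x y) : F.Corr h 1 1 := by
  simp [Corr]

theorem exists_right (h : F.E x y) (a : G x) : ∃ b, F.Corr h a b :=
  (QuotientGroup.mk_surjective (F.φ h a)).imp fun _ hb => hb.symm

theorem exists_left (h : F.E x y) (b : G y) : ∃ a, F.Corr h a b :=
  (QuotientGroup.mk_surjective ((F.φ h).symm b)).imp fun a ha => by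
    rw [Corr, ha, MulEquiv.apply_symm_apply]

theorem one_left_iff : F.Corr h 1 b ↔ b ∈ F.K h := by
  rw [Corr, QuotientGroup.mk_one, map_one, eq_comm, QuotientGroup.eq_one_iff]

theorem one_right_iff : F.Corr h a 1 ↔ a ∈ F.H h := by
  rw [Corr, QuotientGroup.mk_one, map_eq_one_iff _ (F.φ h).injective, QuotientGroup.eq_one_iff]

theorem mk_eq (hab : F.Corr h a b) (hab' : F.Corr h a' b) :
    (a : G x ⧸ F.H h) = (a' : G x ⧸ F.H h) :=
  (F.φ h).injective (hab.trans hab'.symm)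

end Corr

theorem mem_R_iff_corr {h : F.E x y} {a c : G x} {b : G y} :
    ((⟨x, a⟩, ⟨y, b⟩) : F.U × F.U) ∈ F.R h c ↔ F.Corr h (a * c) b :=
  mk_mem_R

end Elements
end GroupTriple

/-! ### The cosets `C_xyz` -/

namespace GroupTriple

variable {I : Type u} {G : I → Type v} [∀ x, Group (G x)] {F : GroupTriple G} {x y z w : I}

section Coset

variable {hxy : F.E x y} {hyz : F.E y z} {hxz : F.E x z} {d d' n : G x}

theorem mem_image {h : F.E x y} {Q : Set (G x)} {b : G y} :
    b ∈ F.image h Q ↔ ∃ a ∈ Q, F.Corr h a b :=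
  Iff.rfl

theorem exists_C_eq (hxy : F.E x y) (hyz : F.E y z) (hxz : F.E x z) :
    ∃ g : G x, ∀ d, d ∈ F.C hxy hyz ↔ g⁻¹ * d ∈ F.H hxy ⊔ F.H hxz := by
  obtain ⟨g, hg⟩ := F.C_coset hxy hyz
  refine ⟨g, fun d => ?_⟩
  rw [hg, ← Subgroup.mul_normal, Set.singleton_mul, Set.image_mul_left, Set.mem_preimage,
    SetLike.mem_coe]

theorem C_mul_mem (hd : d ∈ F.C hxy hyz) (hn : n ∈ F.H hxy ⊔ F.H hxz) :
    d * n ∈ F.C hxy hyz := by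
  obtain ⟨g, hg⟩ := exists_C_eq hxy hyz hxz
  rw [hg] at hd ⊢
  rw [← mul_assoc]
  exact mul_mem hd hn

theorem C_div_mem (hxz : F.E x z) (hd : d ∈ F.C hxy hyz) (hd' : d' ∈ F.C hxy hyz) :
    d⁻¹ * d' ∈ F.H hxy ⊔ F.H hxz := by
  obtain ⟨g, hg⟩ := exists_C_eq hxy hyz hxz
  rw [hg] at hd hd'
  have := mul_mem (inv_mem hd) hd'
  rwa [mul_inv_rev, inv_inv, mul_assoc, mul_inv_cancel_left] at this

/-- Left and right cosets of the normal subgroup `H_xy ⊔ H_xz` agree. -/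
theorem mul_C_mem (hn : n ∈ F.H hxy ⊔ F.H hxz) (hd : d ∈ F.C hxy hyz) :
    n * d ∈ F.C hxy hyz := by
  have := C_mul_mem hd ((Subgroup.sup_normal (F.H hxy) (F.H hxz)).conj_mem n hn d⁻¹)
  simpa [mul_assoc] using this

end Coset

variable (F) in
/-- Multiplication of labels at the level of group elements: `R_{xz,c}` lies in the shifted
product of `R_{xy,a}` and `R_{yz,b}`. -/
def Triple {x y z : I} (hxy : F.E x y) (hyz : F.E y z) (a : G x) (b : G y) (c : G x) : Prop :=
  ∃ b' d, F.Corr hxy b' b ∧ d ∈ F.C hxy hyz ∧ c = a * b' * d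

/-! ### The laws for labels -/

section SemiFrame

variable (hF : F.IsSemiFrame)
include hF

theorem IsSemiFrame.H_symm {h : F.E x y} (h' : F.E y x) : F.H h' = F.K h :=
  (hF.inverse h).1

theorem IsSemiFrame.H_refl (h : F.E x x) : F.H h = ⊥ :=
  (hF.ident x).1

theorem Corr.symm {h : F.E x y} {a : G x} {b : G y} (hab : F.Corr h a b) (h' : F.E y x) :
    F.Corr h' b a :=
  ((hF.inverse h).2.2 a b).1 hab

theorem corr_refl {h : F.E x x} {a b : G x} : F.Corr h a b ↔ a = b := by
  obtain ⟨-, hK, hφ⟩ := hF.ident x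
  refine (show F.Corr h a b ↔ _ from Iff.of_eq (congrArg (· = _) (hφ a))).trans ?_
  rw [QuotientGroup.eq, hK, Subgroup.mem_bot, inv_mul_eq_one]

/-- Semi-frame condition (iii), with `K_xy = H_yx`: corrections modulo `H_xy ∘ H_xz` can be carried
along `φ_xy`. -/
theorem Corr.mem_sup {hxy : F.E x y} {hyx : F.E y x} {hxz : F.E x z} {hyz : F.E y z} {n : G x}
    {m : G y} (hnm : F.Corr hxy n m) (hn : n ∈ F.H hxy ⊔ F.H hxz) :
    m ∈ F.H hyx ⊔ F.H hyz := by
  have : m ∈ F.image hxy ((F.H hxy : Set (G x)) * (F.H hxz : Set (G x))) :=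
    ⟨n, by rwa [← SetLike.mem_coe, Subgroup.mul_normal] at hn, hnm⟩
  rw [hF.image_eq hxy hyz] at this
  rwa [hF.H_symm (h := hxy), ← SetLike.mem_coe, Subgroup.mul_normal]

/-- The composite of `φ_xy` and `φ_yz` is `φ_xz` after conjugation, up to `H_xy ∘ H_xz`. -/
theorem Corr.trans {hxy : F.E x y} {hyz : F.E y z} (hxz : F.E x z) {a d : G x} {b : G y}
    {c : G z} (hd : d ∈ F.C hxy hyz) (hab : F.Corr hxy a b) (hbc : F.Corr hyz b c) :
    ∃ n ∈ F.H hxy ⊔ F.H hxz, F.Corr hxz (d⁻¹ * a * d * n) c := by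
  have : c ∈ F.image hyz (F.image hxy
      ({a} * ((F.H hxy : Set (G x)) * (F.H (F.equiv.trans hxy hyz) : Set (G x))))) :=
    ⟨b, ⟨a, ⟨a, rfl, 1, ⟨1, one_mem _, 1, one_mem _, mul_one 1⟩, mul_one a⟩, hab⟩, hbc⟩
  rw [hF.comp_eq hxy hyz a _ rfl] at this
  obtain ⟨_, ⟨_, ⟨e, he, _, ⟨a', ha', n, hn, rfl⟩, rfl⟩, e', he', rfl⟩, hc⟩ := this
  obtain rfl : a' = a := ha'
  rw [← Subgroup.mul_normal] at hn
  have hN := Subgroup.sup_normal (F.H hxy) (F.H hxz)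
  -- The witness solves `d⁻¹ a' d · w = e a' n e'`. It is trivial modulo `H_xy ⊔ H_xz`, since there
  -- `e = d⁻¹`, `e' = d` and `n = 1`.
  refine ⟨d⁻¹ * a'⁻¹ * d * e * a' * n * e', ?_, ?_⟩
  · have h1 := QuotientGroup.eq.2 (C_div_mem hxz hd (Set.mem_inv.1 he))
    have h2 := QuotientGroup.eq.2 (C_div_mem hxz hd he')
    have h3 := (QuotientGroup.eq_one_iff n).2 (show n ∈ F.H hxy ⊔ F.H hxz from hn)
    rw [QuotientGroup.mk_inv, ← inv_eq_iff_eq_inv] at h1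
    rw [← QuotientGroup.eq_one_iff]
    simp [← h1, ← h2, h3]
  · have hc' : F.Corr hxz (e * (a' * n) * e') c := hc
    convert hc' using 1
    group

/-- Changing `b` within its coset of `H_yz` changes its lift `b₁` by an element of `H_xy ∘ H_xz`, by
semi-frame condition (iii). This change and those of `a` and `c` are all absorbed by the coset
`C_xyz`. -/
theorem Triple.congr {hxy : F.E x y} {hyz : F.E y z} (hxz : F.E x z) {a a' c c' : G x}
    {b b' : G y} (h : F.Triple hxy hyz a b c) (ha : (a : G x ⧸ F.H hxy) = a')
    (hb : (b : G y ⧸ F.H hyz) = b') (hc : (c : G x ⧸ F.H hxz) = c') :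
    F.Triple hxy hyz a' b' c' := by
  obtain ⟨b₁, d, hb₁, hd, rfl⟩ := h
  rw [QuotientGroup.eq] at ha hb hc
  obtain ⟨n, hn⟩ := Corr.exists_left hxy (b⁻¹ * b')
  have hyx := F.equiv.symm hxy
  have hn' : n ∈ F.H hxy ⊔ F.H hxz :=
    (hn.symm hF hyx).mem_sup hF (hxz := hyz) (Subgroup.mem_sup_right hb)
  have hN := Subgroup.sup_normal (F.H hxy) (F.H hxz)
  refine ⟨b₁ * n, (b₁ * n)⁻¹ * a'⁻¹ * c', by simpa using hb₁.mul hn, ?_, by group⟩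
  have h1 := C_mul_mem hd (Subgroup.mem_sup_right (S := F.H hxy) hc)
  have h2 := hN.conj_mem _ (inv_mem (Subgroup.mem_sup_left (T := F.H hxz) ha)) b₁⁻¹
  convert mul_C_mem (mul_mem (inv_mem hn') h2) h1 using 1
  group

/-- The cycle law for labels. -/
theorem Triple.cycle (hC : F.CosetConditions) {hxy : F.E x y} {hyx : F.E y x} {hyz : F.E y z}
    {hxz : F.E x z} {a c : G x} {a₂ b : G y} (h : F.Triple hxy hyz a b c)
    (ha : F.Corr hxy a a₂) : F.Triple hyx hxz a₂⁻¹ c b := by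
  obtain ⟨b', d, hb', hd, rfl⟩ := h
  obtain ⟨d₂, hd₂⟩ := Corr.exists_right hxy d
  have hmem : d₂ ∈ F.image hxy (F.C hxy hyz) := ⟨d, hd, hd₂⟩
  rw [hC.cycle] at hmem
  exact ⟨a₂ * b * d₂, d₂⁻¹, ((ha.mul hb').mul hd₂).symm hF hyx, hmem, by group⟩

/-- The second involution law for labels. -/
theorem Triple.conv (hC : F.CosetConditions) {hxy : F.E x y} {hyx : F.E y x} {hyz : F.E y z}
    {hxz : F.E x z} {hzy : F.E z y} {a c : G x} {a₂ b : G y} {b₃ c₃ : G z}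
    (h : F.Triple hxy hyz a b c) (ha : F.Corr hxy a a₂) (hb : F.Corr hyz b b₃)
    (hc : F.Corr hxz c c₃) : F.Triple hzy hyx b₃⁻¹ a₂⁻¹ c₃⁻¹ := by
  obtain ⟨b', d, hb', hd, rfl⟩ := h
  have hzx := F.equiv.symm hxz
  obtain ⟨d₃, hd₃⟩ := Corr.exists_right hxz d
  have hmem : d₃ ∈ F.image hxz (F.C hxy hyz) := ⟨d, hd, hd₃⟩
  rw [hC.involution] at hmem
  obtain ⟨a₃, ha₃⟩ := Corr.exists_right hyz a₂
  -- Since `c = (a b') d = d (d⁻¹ a b' d n) n⁻¹`, its `φ_xz`-image is represented by `d₃ (a₃ b₃)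
  -- n₃⁻¹`.
  obtain ⟨n, hn, hn'⟩ := Corr.trans hF hxz hd (ha.mul hb') (ha₃.mul hb)
  obtain ⟨n₃, hn₃⟩ := Corr.exists_right hxz n
  rw [sup_comm] at hn
  have hn₃' : n₃ ∈ F.H hzy ⊔ F.H hzx := by
    rw [sup_comm]
    exact hn₃.mem_sup hF hn
  have h1 := (hd₃.mul hn').mul hn₃.inv
  have h2 : c₃⁻¹ * (d₃ * (a₃ * b₃) * n₃⁻¹) ∈ F.H hzx := by
    rw [hF.H_symm (h := hxz), ← Corr.one_left_iff]
    convert hc.inv.mul h1 using 1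
    group
  refine ⟨a₃⁻¹, a₃ * b₃ * c₃⁻¹, ha₃.inv.symm hF hzy, ?_, by group⟩
  have hN := Subgroup.sup_normal (F.H hzy) (F.H hzx)
  have h3 := (QuotientGroup.eq_one_iff n₃).2 hn₃'
  have h4 := QuotientGroup.eq.2 (Subgroup.mem_sup_right (S := F.H hzy) h2)
  have h5 : d₃ * (a₃ * b₃ * c₃⁻¹) ∈ F.H hzy ⊔ F.H hzx := by
    rw [← QuotientGroup.eq_one_iff]
    simp [h4, h3, mul_assoc]
  simpa using C_mul_mem (Set.mem_inv.1 hmem) h5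

/-- One half of the associative law for labels. -/
theorem Triple.assoc (hC : F.CosetConditions) {hxy : F.E x y} {hyz : F.E y z} {hzw : F.E z w}
    {hxz : F.E x z} {hyw : F.E y w} {a e f : G x} {b : G y} {c : G z}
    (h : F.Triple hxy hyz a b e) (h' : F.Triple hxz hzw e c f) :
    ∃ g, F.Triple hyz hzw b c g ∧ F.Triple hxy hyw a g f := by
  obtain ⟨b', d, hb', hd, rfl⟩ := h
  obtain ⟨c', d', hc', hd', rfl⟩ := h'
  -- Pulling `c` back to `G_x` through `G_y` instead of directly turns `c'` into `d⁻¹ c₀ d`, up to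
  -- `H_xy ⊔ H_xz`. This moves `c₀` to the left of `d`, leaving a member of `C_xyz ∘ C_xzw` to which
  -- the associativity condition applies.
  obtain ⟨c₁, hc₁⟩ := Corr.exists_left hyz c
  obtain ⟨c₀, hc₀⟩ := Corr.exists_left hxy c₁
  obtain ⟨n, hn, hn'⟩ := Corr.trans hF hxz hd hc₀ hc₁
  have h1 : c₀⁻¹ * d * c' ∈ F.C hxy hyz := by
    have h2 : (d⁻¹ * c₀ * d * n)⁻¹ * c' ∈ F.H hxz := QuotientGroup.eq.1 (hn'.mk_eq hc')
    convert C_mul_mem hd (mul_mem hn (Subgroup.mem_sup_right (S := F.H hxy) h2)) using 1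
    group
  have h2 : c₀⁻¹ * d * c' * d' ∈ F.C hxy hyz * F.C hxz hzw := Set.mul_mem_mul h1 hd'
  rw [hC.associative hxy hyz hzw] at h2
  obtain ⟨p, ⟨_, ⟨u, hu, k, hk, rfl⟩, huk⟩, q, hq, hpq⟩ := h2
  have hp : F.Corr hxy p u := by
    have hk' : F.Corr _ k 1 := Corr.one_right_iff.2 hk
    simpa using Corr.symm hF (Corr.mul huk hk'.inv) hxy
  refine ⟨b * c₁ * u, ⟨c₁, u, hc₁, hu, rfl⟩, b' * c₀ * p, q, (hb'.mul hc₀).mul hp, hq, ?_⟩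
  have hpq : p * q = c₀⁻¹ * d * c' * d' := hpq
  rw [mul_assoc _ _ q, mul_assoc _ p q, hpq]
  group

omit hF in
theorem triple_refl_iff (hC : F.CosetConditions) {h : F.E x y} {hyy : F.E y y} {a c : G x} :
    F.Triple h hyy a 1 c ↔ (a : G x ⧸ F.H h) = c := by
  rw [QuotientGroup.eq]
  constructor
  · rintro ⟨b', d, hb', hd, rfl⟩
    rw [hC.identity] at hd
    convert mul_mem (Corr.one_right_iff.1 hb') hd using 1
    group
  · intro hac
    refine ⟨1, a⁻¹ * c, Corr.one h, ?_, by group⟩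
    rw [hC.identity]
    exact hac

end SemiFrame
end GroupTriple

/-! ### Operations on frame relations in terms of labels -/

namespace GroupTriple

variable {I : Type u} {G : I → Type v} [∀ x, Group (G x)] {F : GroupTriple G} {x y z w : I}

theorem Hc_subset_iff_triple (hF : F.IsSemiFrame) {hxy : F.E x y} {hyz : F.E y z}
    {hxz : F.E x z} {a c : G x} {b : G y} :
    F.Hc hxz c ⊆ F.preimage hxy (F.Kc hxy a * F.Hc hyz b) * F.C hxy hyz ↔
      F.Triple hxy hyz a b c := by
  constructor
  · intro h
    obtain ⟨a', ⟨_, ⟨k, hk, b₁, hb₁, rfl⟩, ha'⟩, d, hd, hc⟩ := h (show c ∈ F.Hc hxz c from rfl)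
    have hk' : F.Corr hxy a k := Eq.symm hk
    have ha'' : F.Corr hxy a' (k * b₁) := ha'
    have ht : F.Triple hxy hyz a b₁ c :=
      ⟨a⁻¹ * a', d, by simpa using hk'.inv.mul ha'', hd, by simpa using hc.symm⟩
    exact ht.congr hF hxz rfl hb₁ rfl
  · intro h c' hc'
    obtain ⟨b', d, hb', hd, rfl⟩ := h.congr hF hxz rfl rfl (Eq.symm hc')
    obtain ⟨k, hk⟩ := Corr.exists_right hxy a
    exact Set.mul_mem_mul ⟨k * b, Set.mul_mem_mul (Eq.symm hk) rfl, hk.mul hb'⟩ hd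

theorem mem_basicMul_iff (hF : F.IsSemiFrame) {hxy : F.E x y} {hyz : F.E y z} (hxz : F.E x z)
    {a : G x} {b : G y} {p : F.U × F.U} :
    p ∈ F.basicMul hxy hyz a b ↔ ∃ c : G x, F.Triple hxy hyz a b c ∧ p ∈ F.R hxz c := by
  simp only [basicMul, Set.mem_iUnion]
  constructor
  · rintro ⟨γ, hγ, hp⟩
    obtain ⟨c, rfl⟩ := QuotientGroup.mk_surjective γ
    exact ⟨c, (Hc_subset_iff_triple hF).1 hγ, hp⟩
  · rintro ⟨c, hc, hp⟩
    exact ⟨c, (Hc_subset_iff_triple hF).2 hc, hp⟩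

namespace FrameRel

/-- From `φ_xy(s a) = t` and `φ_xy(a) = b` follows `φ_yx(t b⁻¹) = s`, and conversely. -/
theorem swap_mem_R_iff_of_corr (hF : F.IsSemiFrame) {h : F.E x y} (h' : F.E y x) {a : G x}
    {b : G y} (hab : F.Corr h a b) {p : F.U × F.U} :
    (p.2, p.1) ∈ F.R h' (b⁻¹ : G y) ↔ p ∈ F.R h a := by
  obtain ⟨⟨x', s⟩, ⟨y', t⟩⟩ := p
  constructor
  · intro hp
    obtain ⟨_, _, heq, -⟩ := mem_R.1 hp
    simp only [Prod.mk.injEq, Sigma.mk.injEq] at heq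
    obtain ⟨⟨rfl, -⟩, ⟨rfl, -⟩⟩ := heq
    rw [mem_R_iff_corr] at hp ⊢
    simpa using (hp.symm hF h).mul hab
  · intro hp
    obtain ⟨_, _, heq, -⟩ := mem_R.1 hp
    simp only [Prod.mk.injEq, Sigma.mk.injEq] at heq
    obtain ⟨⟨rfl, -⟩, ⟨rfl, -⟩⟩ := heq
    rw [mem_R_iff_corr] at hp ⊢
    simpa using (hp.mul hab.inv).symm hF h'

/-- The shifted product of frame relations. -/
def comp (S T : F.FrameRel) : F.FrameRel :=
  ofSet (F.shiftMul S.toSet T.toSet) fun p hp => by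
    obtain ⟨x, y, z, hxy, hyz, α, β, hα, hβ, hp⟩ := hp
    obtain ⟨γ, hγ, hpγ⟩ := Set.mem_iUnion₂.1 hp
    exact ⟨x, z, _, γ, hpγ, fun q hq =>
      ⟨x, y, z, hxy, hyz, α, β, hα, hβ, Set.mem_iUnion₂.2 ⟨γ, hγ, hq⟩⟩⟩

theorem R_subset_comp (hF : F.IsSemiFrame) {S T : F.FrameRel} {hxz : F.E x z} {c : G x} :
    F.R hxz c ⊆ (S.comp T).toSet ↔
      ∃ (y : I) (hxy : F.E x y) (hyz : F.E y z) (a : G x) (b : G y),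
        F.R hxy a ⊆ S.toSet ∧ F.R hyz b ⊆ T.toSet ∧ F.Triple hxy hyz a b c := by
  constructor
  · intro h
    obtain ⟨p, hp⟩ := R_nonempty hxz (c : G x ⧸ F.H hxz)
    obtain ⟨x', y, z', hxy, hyz, α, β, hα, hβ, hp'⟩ := h hp
    obtain ⟨a, rfl⟩ := QuotientGroup.mk_surjective α
    obtain ⟨b, rfl⟩ := QuotientGroup.mk_surjective β
    obtain ⟨c', hc', hpc⟩ := (mem_basicMul_iff hF (F.equiv.trans hxy hyz)).1 hp'
    obtain ⟨s, t, rfl, -⟩ := mem_R.1 hp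
    obtain ⟨s', t', heq, -⟩ := mem_R.1 hpc
    simp only [Prod.mk.injEq, Sigma.mk.injEq] at heq
    obtain ⟨⟨rfl, -⟩, ⟨rfl, -⟩⟩ := heq
    exact ⟨y, hxy, hyz, a, b, hα, hβ, hc'.congr hF hxz rfl rfl (index_unique hpc hp)⟩
  · rintro ⟨y, hxy, hyz, a, b, ha, hb, hc⟩ p hp
    exact ⟨x, y, z, hxy, hyz, a, b, ha, hb, (mem_basicMul_iff hF hxz).2 ⟨c, hc, hp⟩⟩

/-- The converse of a frame relation. -/
def conv (hF : F.IsSemiFrame) (S : F.FrameRel) : F.FrameRel :=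
  ofSet {p | (p.2, p.1) ∈ S.toSet} fun p hp => by
    obtain ⟨x, y, h, α, hα, hs⟩ := S.exists_R_subset hp
    obtain ⟨a, rfl⟩ := QuotientGroup.mk_surjective α
    obtain ⟨b, hb⟩ := Corr.exists_right h a
    have h' := F.equiv.symm h
    exact ⟨y, x, h', (b⁻¹ : G y), (swap_mem_R_iff_of_corr hF h' hb (p := (p.2, p.1))).2 hα,
      fun q hq => hs ((swap_mem_R_iff_of_corr hF h' hb (p := (q.2, q.1))).1 hq)⟩

theorem R_subset_conv (hF : F.IsSemiFrame) {S : F.FrameRel} {h : F.E x y} (h' : F.E y x)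
    {a : G x} {b : G y} (hab : F.Corr h a b) :
    F.R h a ⊆ (S.conv hF).toSet ↔ F.R h' (b⁻¹ : G y) ⊆ S.toSet :=
  ⟨fun H p hp => H ((swap_mem_R_iff_of_corr hF h' hab (p := (p.2, p.1))).1 hp),
    fun H _ hp => H ((swap_mem_R_iff_of_corr hF h' hab).2 hp)⟩

theorem conv_conv (hF : F.IsSemiFrame) (S : F.FrameRel) : (S.conv hF).conv hF = S :=
  rfl

theorem mem_R_refl_one (hF : F.IsSemiFrame) {h : F.E x x} {p : F.U × F.U} :
    p ∈ F.R h (1 : G x) ↔ ∃ a : G x, p = (⟨x, a⟩, ⟨x, a⟩) := by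
  rw [mem_R]
  constructor
  · rintro ⟨a, b, rfl, hab⟩
    have : F.Corr h (a * 1) b := hab
    rw [corr_refl hF, mul_one] at this
    exact ⟨a, by rw [this]⟩
  · rintro ⟨a, rfl⟩
    exact ⟨a, a, rfl, (corr_refl hF).2 (mul_one a)⟩

/-- The identity relation as a frame relation. -/
def ident (hF : F.IsSemiFrame) : F.FrameRel :=
  ofSet {p | p.1 = p.2} fun p hp => by
    obtain ⟨⟨x, a⟩, q⟩ := p
    obtain rfl : ⟨x, a⟩ = q := hp
    refine ⟨x, x, F.equiv.refl x, (1 : G x), (mem_R_refl_one hF).2 ⟨a, rfl⟩, fun q hq => ?_⟩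
    obtain ⟨b, rfl⟩ := (mem_R_refl_one hF).1 hq
    rfl

theorem R_subset_ident (hF : F.IsSemiFrame) {h : F.E x y} {a : G x} :
    F.R h a ⊆ (ident hF).toSet ↔ x = y ∧ a = 1 := by
  constructor
  · intro H
    -- The pair of the block with first coordinate `1` suffices: lying on the diagonal forces `x =
    -- y` and `b = 1`, hence `a = 1`.
    obtain ⟨b, hb⟩ := Corr.exists_right h (1 * a)
    have hp := H (mem_R_iff_corr.2 hb)
    have hp : (⟨x, 1⟩ : F.U) = ⟨y, b⟩ := hp
    simp only [Sigma.mk.injEq] at hp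
    obtain ⟨rfl, hp⟩ := hp
    obtain rfl := eq_of_heq hp
    rw [corr_refl hF, one_mul] at hb
    exact ⟨rfl, hb⟩
  · rintro ⟨rfl, rfl⟩ p hp
    obtain ⟨b, rfl⟩ := (mem_R_refl_one hF).1 hp
    rfl

theorem sup_comp (hF : F.IsSemiFrame) (S T V : F.FrameRel) :
    (S ⊔ T).comp V = S.comp V ⊔ T.comp V := by
  refine le_antisymm (le_iff_R.2 fun x z h c hc => ?_) (le_iff_R.2 fun x z h c hc => ?_)
  · obtain ⟨y, hxy, hyz, a, b, ha, hb, ht⟩ := (R_subset_comp hF).1 hc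
    rw [R_subset_sup, R_subset_comp hF, R_subset_comp hF]
    exact (R_subset_sup.1 ha).imp (fun ha => ⟨y, hxy, hyz, a, b, ha, hb, ht⟩)
      fun ha => ⟨y, hxy, hyz, a, b, ha, hb, ht⟩
  · rw [R_subset_sup, R_subset_comp hF, R_subset_comp hF] at hc
    rw [R_subset_comp hF]
    rcases hc with ⟨y, hxy, hyz, a, b, ha, hb, ht⟩ | ⟨y, hxy, hyz, a, b, ha, hb, ht⟩
    · exact ⟨y, hxy, hyz, a, b, R_subset_sup.2 (.inl ha), hb, ht⟩
    · exact ⟨y, hxy, hyz, a, b, R_subset_sup.2 (.inr ha), hb, ht⟩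

/-! ### The relation algebra axioms -/

section CosetConditions

variable (hF : F.IsSemiFrame) (hC : F.CosetConditions)
include hF hC

theorem comp_ident (S : F.FrameRel) : S.comp (ident hF) = S := by
  refine le_antisymm (le_iff_R.2 fun x z h c hc => ?_) (le_iff_R.2 fun x z h c hc => ?_)
  · obtain ⟨y, hxy, hyz, a, b, ha, hb, ht⟩ := (R_subset_comp hF).1 hc
    obtain ⟨rfl, rfl⟩ := (R_subset_ident hF).1 hb
    rwa [← (triple_refl_iff hC).1 ht]
  · rw [R_subset_comp hF]
    exact ⟨z, h, F.equiv.refl z, c, 1, hc, (R_subset_ident hF).2 ⟨rfl, rfl⟩,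
      (triple_refl_iff hC).2 rfl⟩

theorem conv_comp_le (S T : F.FrameRel) :
    (S.comp T).conv hF ≤ (T.conv hF).comp (S.conv hF) := by
  refine le_iff_R.2 fun z x hzx c hc => ?_
  have hxz := F.equiv.symm hzx
  obtain ⟨c', hc'⟩ := Corr.exists_right hzx c
  obtain ⟨y, hxy, hyz, a, b, ha, hb, ht⟩ :=
    (R_subset_comp hF).1 ((R_subset_conv hF hxz hc').1 hc)
  have hyx := F.equiv.symm hxy
  have hzy := F.equiv.symm hyz
  obtain ⟨a₂, ha₂⟩ := Corr.exists_right hxy a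
  obtain ⟨b₃, hb₃⟩ := Corr.exists_right hyz b
  refine (R_subset_comp hF).2 ⟨y, hzy, hyx, b₃⁻¹, a₂⁻¹,
    (R_subset_conv hF hyz (hb₃.inv.symm hF hzy)).2 (by simpa using hb),
    (R_subset_conv hF hxy (ha₂.inv.symm hF hyx)).2 (by simpa using ha), ?_⟩
  simpa using ht.conv hF hC (hzy := hzy) (hyx := hyx) ha₂ hb₃ (hc'.inv.symm hF hxz)

omit hC in
theorem conv_mono {S T : F.FrameRel} (h : S ≤ T) : S.conv hF ≤ T.conv hF :=
  fun _ hp => h hp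

theorem conv_comp (S T : F.FrameRel) :
    (S.comp T).conv hF = (T.conv hF).comp (S.conv hF) := by
  refine le_antisymm (conv_comp_le hF hC S T) ?_
  -- The first inclusion for the converses of `T` and `S` reads `(T˘;S˘)˘ ≤ S;T`; taking converses
  -- gives the reverse inclusion.
  exact conv_mono hF (conv_comp_le hF hC (T.conv hF) (S.conv hF))

theorem comp_comp_le (S T V : F.FrameRel) : (S.comp T).comp V ≤ S.comp (T.comp V) := by
  refine le_iff_R.2 fun x w hxw f hf => ?_
  obtain ⟨z, hxz, hzw, e, c, he, hc, ht⟩ := (R_subset_comp hF).1 hf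
  obtain ⟨y, hxy, hyz, a, b, ha, hb, ht'⟩ := (R_subset_comp hF).1 he
  have hyw := F.equiv.trans hyz hzw
  obtain ⟨g, hg, hg'⟩ := ht'.assoc hF hC (hyw := hyw) ht
  exact (R_subset_comp hF).2
    ⟨y, hxy, hyw, a, g, ha, (R_subset_comp hF).2 ⟨z, hyz, hzw, b, c, hb, hc, hg⟩, hg'⟩

theorem comp_assoc (S T V : F.FrameRel) : S.comp (T.comp V) = (S.comp T).comp V := by
  refine le_antisymm ?_ (comp_comp_le hF hC S T V)
  -- Converse reverses products, so the half already proved, applied to `V˘, T˘, S˘`, yields the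
  -- other half.
  have := conv_mono hF (comp_comp_le hF hC (V.conv hF) (T.conv hF) (S.conv hF))
  simpa only [conv_comp hF hC, conv_conv] using this

theorem cycle (S T V : F.FrameRel) (h : S.comp T ⊓ V = ⊥) : (S.conv hF).comp V ⊓ T = ⊥ := by
  rw [inf_eq_bot_iff] at h ⊢
  intro y z hyz b hb hT
  obtain ⟨x, hyx, hxz, a, c, ha, hc, ht⟩ := (R_subset_comp hF).1 hb
  have hxy := F.equiv.symm hyx
  obtain ⟨a₁, ha₁⟩ := Corr.exists_right hyx a
  refine h x z hxz c ((R_subset_comp hF).2 ⟨y, hxy, hyz, a₁⁻¹, b,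
    (R_subset_conv hF hxy ha₁).1 ha, hT, ht.cycle hF hC ha₁⟩) hc

omit hC in
/-- The relation algebra of frame relations. -/
@[reducible]
def relationAlgebra (hC : F.CosetConditions) : RelationAlgebra F.FrameRel where
  comp := comp
  conv := conv hF
  ident := ident hF
  comp_assoc := comp_assoc hF hC
  comp_ident := comp_ident hF hC
  conv_conv := conv_conv hF
  conv_comp := conv_comp hF hC
  sup_comp := sup_comp hF
  conv_sup _ _ := rfl
  cycle := cycle hF hC

end CosetConditions
end FrameRel
end GroupTriple

/-! ### Measurability and measures -/

namespace GroupTriple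

variable {I : Type u} {G : I → Type v} [∀ x, Group (G x)] {F : GroupTriple G} {x y z w : I}

theorem eq_of_R_subset_R {h : F.E x y} {h' : F.E z w} {α : G x ⧸ F.H h} {β : G z ⧸ F.H h'}
    (hs : F.R h α ⊆ F.R h' β) : x = z ∧ y = w := by
  obtain ⟨p, hp⟩ := R_nonempty h α
  obtain ⟨a, b, rfl, -⟩ := mem_R.1 hp
  obtain ⟨a', b', heq, -⟩ := mem_R.1 (hs hp)
  simp only [Prod.mk.injEq, Sigma.mk.injEq] at heq
  exact ⟨heq.1.1, heq.2.1⟩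

theorem eq_of_R_refl_subset (hF : F.IsSemiFrame) {h h' : F.E x x} {a b : G x}
    (hs : F.R h a ⊆ F.R h' b) : a = b := by
  obtain ⟨p, hp⟩ := R_nonempty h (a : G x ⧸ F.H h)
  have hab := index_unique hp (hs hp)
  rw [QuotientGroup.eq, hF.H_refl, Subgroup.mem_bot, inv_mul_eq_one] at hab
  exact hab

theorem triple_refl_refl (hF : F.IsSemiFrame) (hC : F.CosetConditions) {h h' : F.E x x}
    {a b : G x} : F.Triple h h' a b (a * b) := by
  refine ⟨b, 1, (corr_refl hF).2 rfl, ?_, by simp⟩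
  have := hC.identity h
  rw [this]
  exact one_mem _

namespace FrameRel

variable (hF : F.IsSemiFrame) (hC : F.CosetConditions)
include hF hC

theorem R_subset_square {h : F.E y z} {a : G y} :
    F.R h a ⊆ (((F.basic (F.equiv.refl x) (1 : G x)).comp ⊤).comp
      (F.basic (F.equiv.refl x) (1 : G x))).toSet ↔ y = x ∧ z = x := by
  constructor
  · intro H
    obtain ⟨v, hyv, hvz, b, c, hb, hc, -⟩ := (R_subset_comp hF).1 H
    obtain ⟨u, hyu, huv, d, e, hd, -, -⟩ := (R_subset_comp hF).1 hb
    exact ⟨(eq_of_R_subset_R hd).1, (eq_of_R_subset_R hc).2⟩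
  · rintro ⟨rfl, rfl⟩
    refine (R_subset_comp hF).2 ⟨_, h, h, a, 1, ?_, subset_rfl, ?_⟩
    · refine (R_subset_comp hF).2 ⟨_, h, h, 1, a, subset_rfl, R_subset_unitRel h _, ?_⟩
      simpa using triple_refl_refl hF hC (h := h) (h' := h) (a := 1) (b := a)
    · exact (triple_refl_iff hC).2 rfl

/-- The label of the product is `a⁻¹ · a · d` with `d ∈ C_xxx = {1}`. -/
theorem conv_comp_basic_le (h : F.E x x) (a : G x) :
    ((F.basic h a).conv hF).comp (F.basic h a) ≤ ident hF := by
  refine le_iff_R.2 fun y z hyz c hc => ?_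
  obtain ⟨v, hyv, hvz, p, b, hp, hb, ht⟩ := (R_subset_comp hF).1 hc
  obtain ⟨q, hq⟩ := Corr.exists_right hyv p
  replace hp : _ ⊆ F.R h a := (R_subset_conv hF (F.equiv.symm hyv) hq).1 hp
  replace hb : _ ⊆ F.R h a := hb
  obtain ⟨rfl, rfl⟩ := eq_of_R_subset_R hp
  obtain ⟨-, rfl⟩ := eq_of_R_subset_R hb
  obtain rfl := eq_of_R_refl_subset hF hb
  obtain rfl := eq_of_R_refl_subset hF hp
  rw [corr_refl hF] at hq
  subst hq
  obtain ⟨b', d, hb', hd, rfl⟩ := ht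
  rw [corr_refl hF] at hb'
  have hd' : d ∈ (F.H h : Set (G z)) := hC.identity h ▸ hd
  rw [hF.H_refl, SetLike.mem_coe, Subgroup.mem_bot] at hd'
  refine (R_subset_ident hF).2 ⟨rfl, ?_⟩
  simp [hb', hd']

/-- If `S` contained the blocks of both `a` and `b`, then `S˘;S` would contain that of `a⁻¹b`, which
lies in the identity only when `a = b`. -/
theorem eq_basic_of_functional {S : F.FrameRel} (hne : S ≠ ⊥) (hS : (S.conv hF).comp S ≤ ident hF)
    (hle : S ≤ ((F.basic (F.equiv.refl x) (1 : G x)).comp ⊤).comp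
      (F.basic (F.equiv.refl x) (1 : G x))) :
    ∃ a : G x, S = F.basic (F.equiv.refl x) a := by
  obtain ⟨y, z, h, α, hα⟩ := exists_basic_le hne
  obtain ⟨a, rfl⟩ := QuotientGroup.mk_surjective α
  obtain ⟨rfl, rfl⟩ := (R_subset_square hF hC).1 (le_iff_R.1 hle _ _ h a hα)
  refine ⟨a, le_antisymm (le_iff_R.2 fun y' z' h' b hb => ?_) hα⟩
  obtain ⟨rfl, rfl⟩ := (R_subset_square hF hC).1 (le_iff_R.1 hle _ _ h' b hb)
  have hconv : F.R h (a⁻¹ : G z') ⊆ (S.conv hF).toSet :=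
    (R_subset_conv hF h ((corr_refl hF).2 rfl)).2 (by rw [inv_inv]; exact hα)
  have hid : F.R h (a⁻¹ * b : G z') ⊆ (ident hF).toSet := Set.Subset.trans
    ((R_subset_comp hF).2 ⟨z', h, h, a⁻¹, b, hconv, hb, triple_refl_refl hF hC⟩) hS
  have hab := ((R_subset_ident hF (a := a⁻¹ * b)).1 hid).2
  rw [inv_mul_eq_one] at hab
  rw [hab]
  exact subset_rfl

theorem isLUB_square (x : I) :
    IsLUB (Set.range fun a : G x => F.basic (F.equiv.refl x) a)
      (((F.basic (F.equiv.refl x) (1 : G x)).comp ⊤).comp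
        (F.basic (F.equiv.refl x) (1 : G x))) := by
  constructor
  · rintro _ ⟨a, rfl⟩
    exact (R_subset_square hF hC).2 ⟨rfl, rfl⟩
  · intro T hT
    refine le_iff_R.2 fun y z h a ha => ?_
    obtain ⟨rfl, rfl⟩ := (R_subset_square hF hC).1 ha
    exact hT ⟨a, rfl⟩

omit hC in
theorem basic_le_ident_iff {h : F.E x y} {a : G x} :
    F.basic h a ≤ ident hF ↔ x = y ∧ a = 1 :=
  R_subset_ident hF

omit hC in
theorem isLUB_ident :
    IsLUB (Set.range fun x : I => F.basic (F.equiv.refl x) (1 : G x)) (ident hF) := by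
  constructor
  · rintro _ ⟨x, rfl⟩
    exact (basic_le_ident_iff hF).2 ⟨rfl, rfl⟩
  · intro T hT
    refine le_iff_R.2 fun x y h a ha => ?_
    obtain ⟨rfl, rfl⟩ := (R_subset_ident hF).1 ha
    exact hT ⟨x, rfl⟩

theorem isMeasurableElement_basic (x : I) :
    @RelationAlgebra.IsMeasurableElement _ (relationAlgebra hF hC)
      (F.basic (F.equiv.refl x) (1 : G x)) := by
  refine ⟨(basic_le_ident_iff hF).2 ⟨rfl, rfl⟩, isAtom_basic _ _, _, ?_, isLUB_square hF hC x⟩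
  rintro _ ⟨a, rfl⟩
  exact conv_comp_basic_le hF hC _ a

theorem measure_basic (x : I) :
    @RelationAlgebra.measure _ (relationAlgebra hF hC) (F.basic (F.equiv.refl x) (1 : G x)) =
      Cardinal.lift.{u} (Cardinal.mk (G x)) := by
  let _ := relationAlgebra hF hC
  let e : G x → {f : F.FrameRel // f ≠ ⊥ ∧ RelationAlgebra.IsFunctional f ∧
      f ≤ RelationAlgebra.square (F.basic (F.equiv.refl x) (1 : G x))} := fun a =>
    ⟨F.basic (F.equiv.refl x) a, basic_ne_bot _ _, conv_comp_basic_le hF hC _ a,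
      (isLUB_square hF hC x).1 ⟨a, rfl⟩⟩
  have he : Function.Bijective e := by
    constructor
    · intro a b hab
      exact eq_of_R_refl_subset hF (congrArg FrameRel.toSet (congrArg Subtype.val hab)).le
    · rintro ⟨S, hne, hS, hle⟩
      obtain ⟨a, rfl⟩ := eq_basic_of_functional hF hC hne hS hle
      exact ⟨a, rfl⟩
  have := Cardinal.mk_congr_lift (Equiv.ofBijective e he)
  -- Frame relations live in universe `max u v`, so only the cardinal of `G x` is genuinely lifted.
  rw [← Cardinal.lift_umax.{v, u}, this]
  exact (Cardinal.lift_id'.{v, max u v} _).symm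

end FrameRel
end GroupTriple

/-- If a group triple is a semi-frame and satisfies the coset conditions, then its frame
relations, with union, complement relative to the unit, shifted product, converse and identity
relation, form a complete, atomic, measurable relation algebra with the stated base set, unit,
atoms, subidentity atoms and measures. -/
theorem mainTheorem1 {I : Type u} {G : I → Type v} [∀ x, Group (G x)] (F : GroupTriple G)
    (hF : F.IsSemiFrame) (hC : F.CosetConditions) :
    ∃ _ : RelationAlgebra F.FrameRel,
      -- the operations of the algebra
      (∀ S T : F.FrameRel, (S ⊔ T).toSet = S.toSet ∪ T.toSet) ∧
      (∀ S : F.FrameRel, (Sᶜ).toSet = F.unitRel \ S.toSet) ∧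
      (∀ S T : F.FrameRel, (RelationAlgebra.comp S T).toSet = F.shiftMul S.toSet T.toSet) ∧
      (∀ S : F.FrameRel, (RelationAlgebra.conv S).toSet = {p | (p.2, p.1) ∈ S.toSet}) ∧
      (RelationAlgebra.ident : F.FrameRel).toSet = {p | p.1 = p.2} ∧
      -- the unit, and the base set as the field of the unit
      (⊤ : F.FrameRel).toSet = F.unitRel ∧
      {a : F.U | ∃ b : F.U, (a, b) ∈ (⊤ : F.FrameRel).toSet} = Set.univ ∧
      -- complete, atomic, measurable
      (∀ 𝒮 : Set F.FrameRel, ∃ T : F.FrameRel, IsLUB 𝒮 T) ∧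
      IsAtomic F.FrameRel ∧
      RelationAlgebra.IsMeasurableAlgebra F.FrameRel ∧
      -- the atoms, the subidentity atoms, and their measures
      (∀ S : F.FrameRel, IsAtom S ↔
        ∃ (x y : I) (h : F.E x y) (α : G x ⧸ F.H h), S = F.basic h α) ∧
      (∀ S : F.FrameRel, (IsAtom S ∧ S ≤ RelationAlgebra.ident) ↔
        ∃ x : I, S = F.basic (F.equiv.refl x) 1) ∧
      (∀ x : I, RelationAlgebra.IsMeasurableElement (F.basic (F.equiv.refl x) 1) ∧
        RelationAlgebra.measure (F.basic (F.equiv.refl x) 1) =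
          Cardinal.lift.{u} (Cardinal.mk (G x))) := by
  refine ⟨GroupTriple.FrameRel.relationAlgebra hF hC, fun _ _ => rfl, fun _ => rfl,
    fun _ _ => rfl, fun _ => rfl, rfl, rfl, ?_, fun 𝒮 => ⟨_, GroupTriple.FrameRel.isLUB_union 𝒮⟩,
    GroupTriple.isAtomic_frameRel, ?_, fun _ => GroupTriple.isAtom_iff, fun S => ?_, fun x =>
    ⟨GroupTriple.FrameRel.isMeasurableElement_basic hF hC x,
      GroupTriple.FrameRel.measure_basic hF hC x⟩⟩
  · exact Set.eq_univ_of_forall fun a => ⟨a, F.equiv.refl a.1⟩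
  · refine ⟨_, ?_, GroupTriple.FrameRel.isLUB_ident hF⟩
    rintro _ ⟨x, rfl⟩
    exact GroupTriple.FrameRel.isMeasurableElement_basic hF hC x
  · constructor
    · rintro ⟨hS, hle⟩
      obtain ⟨x, y, h, α, rfl⟩ := GroupTriple.isAtom_iff.1 hS
      obtain ⟨a, rfl⟩ := QuotientGroup.mk_surjective α
      obtain ⟨rfl, rfl⟩ := (GroupTriple.FrameRel.basic_le_ident_iff hF).1 hle
      exact ⟨x, rfl⟩
    · rintro ⟨x, rfl⟩
      exact ⟨GroupTriple.isAtom_basic _ _,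
        (GroupTriple.FrameRel.basic_le_ident_iff hF (a := (1 : G x))).2 ⟨rfl, rfl⟩⟩
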